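/- Let $a>0$, $\kappa\in\mathbb{Z}+\tfrac12$, and let $N$ be an integer. For $E\in[0,1]$ and $\lambda\in\mathbb{R}$ consider on $[0,\pi]\times\mathbb{R}$ (the universal cover of the cylinder $[0,\pi]\times\mathbb{S}^1$) the dynamical system $$\dot\theta=\sin\theta,\qquad \dot\Theta=-2a\sin\theta\cos\theta\cos\Theta+2aE\sin^2\theta\sin\Theta-2\kappa\sin\Theta+2\lambda\sin\theta .$$ Put $S^-=(0,0)$, $S^+=(\pi,-\pi)$ if $\kappa>0$, and $S^-=(0,\pi)$, $S^+=(\pi,0)$ if $\kappa<0$; on the cylinder these are saddle points of the system. A \emph{saddles connector with winding number $N$} is an orbit $(\theta(\tau),\Theta(\tau))$, $\tau\in\mathbb{R}$, with $0<\theta(\tau)<\pi$, which converges to $S^-$ as $\tau\to-\infty$ and to $S^+-(0,2\pi N)$ as $\tau\to+\infty$. Then for every $E\in[0,1]$ there is exactly one $\lambda=\lambda_N(E)\in\mathbb{R}$ for which the system has a saddles connector with winding number $N$. The function $E\mapsto\lambda_N(E)$ is $C^1$ on $[0,1]$ (with one-sided derivatives at the endpoints), and $|\lambda_N'(E)|<a$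 for all $E\in[0,1]$. -/

import Mathlib

open Set Filter Topology

namespace ThetaSystem

noncomputable section

/-- The vector field of the `Θ`-system on the universal cover `[0, π] × ℝ` of the cylinder
`[0, π] × 𝕊¹`; a point is `p = (θ, Θ)`. -/
def field (a E κ lam : ℝ) (p : ℝ × ℝ) : ℝ × ℝ :=
  (Real.sin p.1,
    -2 * a * Real.sin p.1 * Real.cos p.1 * Real.cos p.2
      + 2 * a * E * Real.sin p.1 ^ 2 * Real.sin p.2
      - 2 * κ * Real.sin p.2 + 2 * lam * Real.sin p.1)

/-- The saddle `S⁻` on the left boundary, as a point of the fundamental domain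
(`[0, π] × [-π, π)` if `κ > 0`, and `[0, π] × [0, 2π)` if `κ < 0`). -/
def saddleLeft (κ : ℝ) : ℝ × ℝ := (0, if 0 < κ then 0 else Real.pi)

/-- The saddle `S⁺` on the right boundary, as a point of the fundamental domain. -/
def saddleRight (κ : ℝ) : ℝ × ℝ := (Real.pi, if 0 < κ then -Real.pi else 0)

/-- The node `N⁺` on the right boundary, as a point of the fundamental domain. -/
def nodeRight (κ : ℝ) : ℝ × ℝ := (Real.pi, if 0 < κ then 0 else Real.pi)

/-- The copy of the point `p` of the fundamental domain that lies `k` turns below `p` in the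
universal cover. -/
def copy (p : ℝ × ℝ) (k : ℤ) : ℝ × ℝ := (p.1, p.2 - 2 * Real.pi * k)

/-- A non-boundary orbit of the `Θ`-system, lifted to the universal cover and parametrized by the
time `τ ∈ ℝ`. -/
structure IsNonBoundaryOrbit (a E κ lam : ℝ) (γ : ℝ → ℝ × ℝ) : Prop where
  mem : ∀ τ, (γ τ).1 ∈ Ioo 0 Real.pi
  hasDerivAt : ∀ τ, HasDerivAt γ (field a E κ lam (γ τ)) τ

/-- `γ` parametrizes the lifted unstable manifold of `S⁻`: the (unique up to time translation)
non-boundary orbit whose `α`-limit point is `S⁻`. -/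
structure IsUnstableOrbit (a E κ lam : ℝ) (γ : ℝ → ℝ × ℝ) : Prop
    extends IsNonBoundaryOrbit a E κ lam γ where
  tendsto_atBot : Tendsto γ atBot (𝓝 (saddleLeft κ))

/-- An orbit issuing from `S⁻` in the fundamental domain has winding number `k` if its `ω`-limit
point is the copy of `S⁺` or the copy of `N⁺` that lies `k` turns below the fundamental domain. -/
def HasWindingNumber (κ : ℝ) (γ : ℝ → ℝ × ℝ) (k : ℤ) : Prop :=
  Tendsto γ atTop (𝓝 (copy (saddleRight κ) k)) ∨ Tendsto γ atTop (𝓝 (copy (nodeRight κ) k))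

/-- The lifted unstable manifold is a saddles connector: its `ω`-limit point is a copy of `S⁺`. -/
def IsSaddlesConnector (a E κ lam : ℝ) (γ : ℝ → ℝ × ℝ) : Prop :=
  IsUnstableOrbit a E κ lam γ ∧ ∃ k : ℤ, Tendsto γ atTop (𝓝 (copy (saddleRight κ) k))

/-- For the parameters `a, E, κ, lam`, the `Θ`-system has a saddles connector of winding
number `N`. -/
def HasConnector (a E κ lam : ℝ) (N : ℤ) : Prop :=
  ∃ γ : ℝ → ℝ × ℝ, IsSaddlesConnector a E κ lam γ ∧ HasWindingNumber κ γ N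

end

end ThetaSystem

namespace ThetaSystem

noncomputable section

open Real MeasureTheory

/-! The equation for `θ` decouples and has one solution in `(0, π)` up to time shift, so a connector
is a solution of a nonautonomous scalar equation for `x`, with coefficients `A = ±a`, `G = ±aE` and
parameter `l`, running from `0` to `-π - 2πN`. If `κ < 0`, shifting `Θ` by `π` flips the signs of
`a` and `κ`, so `κ > 0` may be assumed.

The difference of two solutions with the same `A` and `κ` satisfies a linear equation `(y - x)' = b
(y - x) + source`, where the source is linear in the changes of `G` and `l` (`rhs_sub`). Between
connectors, `b` is at most `-κ/2` near the left saddle and at least `κ/2` near the right one, so the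
integrating factor `w = exp (-∫ b)` decays exponentially at both ends (`exists_weight_le`).
Integrating `((y - x) w)'` over the line leaves no boundary terms, and with `s = sin θ` this gives
(`sub_mul_den_eq`) `(l₂ - l₁) ∫ w s = -(G₂ - G₁) ∫ w s² sin y`.

Since `s² |sin y| ≤ s`, strictly somewhere, the quotient of the integrals is less than `1` in
absolute value. Hence `l` is unique for given `G` and is 1-Lipschitz in `G`. Dominated convergence
carries the quotient to the diagonal, which gives a continuous derivative of absolute value below
`1`; the substitution `G = ±aE` turns `1` into `a`.

Existence is by shooting: the intermediate value theorem in `l` joins `0` at time `-T` to the target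
at time `T`, with `l` bounded independently of `T`. A subsequence converges as `T → ∞`, and
invariant intervals near the saddles, uniform in the sequence, fix the limits at both ends
(`exists_isConn`). -/

/-! ### The polar angle along a non-boundary orbit -/

/-- The solution of `θ' = sin θ` in `(0, π)` with `θ(0) = π / 2`. -/
def polar (τ : ℝ) : ℝ := 2 * arctan (exp τ)

/-- The sine of the polar angle. -/
def sp (τ : ℝ) : ℝ := sin (polar τ)

/-- The cosine of the polar angle. -/
def cp (τ : ℝ) : ℝ := cos (polar τ)

lemma polar_pos (τ : ℝ) : 0 < polar τ := by
  have := arctan_pos.2 (exp_pos τ)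
  unfold polar; linarith

lemma polar_lt_pi (τ : ℝ) : polar τ < π := by
  have := arctan_lt_pi_div_two (exp τ)
  unfold polar; linarith

lemma polar_neg (τ : ℝ) : polar (-τ) = π - polar τ := by
  unfold polar
  rw [exp_neg, arctan_inv_of_pos (exp_pos τ)]; ring

lemma sp_pos (τ : ℝ) : 0 < sp τ := sin_pos_of_pos_of_lt_pi (polar_pos τ) (polar_lt_pi τ)

lemma sp_le_one (τ : ℝ) : sp τ ≤ 1 := sin_le_one _

lemma abs_cp_le_one (τ : ℝ) : |cp τ| ≤ 1 := abs_cos_le_one _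

lemma sp_neg (τ : ℝ) : sp (-τ) = sp τ := by
  unfold sp; rw [polar_neg, sin_pi_sub]

lemma cp_neg (τ : ℝ) : cp (-τ) = -cp τ := by
  unfold cp; rw [polar_neg, cos_pi_sub]

lemma continuous_polar : Continuous polar := by unfold polar; fun_prop

@[fun_prop] lemma continuous_sp : Continuous sp := continuous_sin.comp continuous_polar

@[fun_prop] lemma continuous_cp : Continuous cp := continuous_cos.comp continuous_polar

lemma sp_eq (τ : ℝ) : sp τ = 2 * exp τ / (1 + exp τ ^ 2) := by
  unfold sp polar
  have h : (0 : ℝ) < 1 + exp τ ^ 2 := by positivity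
  rw [sin_two_mul, sin_arctan, cos_arctan]
  have := mul_self_sqrt h.le
  field_simp
  rw [sq_sqrt h.le]

lemma hasDerivAt_polar (τ : ℝ) : HasDerivAt polar (sp τ) τ := by
  have h := ((hasDerivAt_exp τ).arctan).const_mul 2
  rw [sp_eq]
  exact h.congr_deriv (by ring)

/-- Supplies a point where `sp ^ 2 < sp`, the source of the strict inequality in the derivative
bound. -/
lemma sp_one_lt_one : sp 1 < 1 := by
  rw [sp_eq, div_lt_one (by positivity)]
  have : (1 : ℝ) < exp 1 := one_lt_exp_iff.2 one_pos
  nlinarith [sq_nonneg (exp 1 - 1), sq_pos_of_pos (sub_pos.2 this)]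

lemma tendsto_polar_atBot : Tendsto polar atBot (𝓝 0) := by
  have := ((continuous_arctan.tendsto 0).comp tendsto_exp_atBot).const_mul 2
  simpa [polar, Function.comp_def] using! this

lemma tendsto_polar_atTop : Tendsto polar atTop (𝓝 π) := by
  have h := (tendsto_arctan_atTop.mono_right nhdsWithin_le_nhds).comp tendsto_exp_atTop
  have := h.const_mul 2
  rw [show 2 * (π / 2) = π by ring] at this
  exact this

lemma tendsto_sp_atBot : Tendsto sp atBot (𝓝 0) := by
  have := (continuous_sin.tendsto 0).comp tendsto_polar_atBot
  simpa using! this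

lemma exists_sp_lt {η : ℝ} (hη : 0 < η) : ∃ T : ℝ, 0 < T ∧ ∀ τ, T ≤ |τ| → sp τ < η := by
  obtain ⟨T, hT⟩ := eventually_atBot.1 (tendsto_sp_atBot.eventually (gt_mem_nhds hη))
  refine ⟨max 1 (-T), by positivity, fun τ h => ?_⟩
  have h1 : -T ≤ |τ| := (le_max_right _ _).trans h
  rcases abs_cases τ with ⟨h2, _⟩ | ⟨h2, _⟩
  · rw [← sp_neg]; exact hT _ (by linarith)
  · exact hT _ (by linarith)

/-! ### The scalar equation -/

/-- The azimuthal component of the vector field along the orbits `θ = polar τ`. -/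
def rhs (A G κ l τ x : ℝ) : ℝ :=
  -2 * A * sp τ * cp τ * cos x + (2 * G * sp τ ^ 2 - 2 * κ) * sin x + 2 * l * sp τ

/-- Solutions of the scalar equation. -/
def IsSol (A G κ l : ℝ) (x : ℝ → ℝ) : Prop := ∀ τ, HasDerivAt x (rhs A G κ l τ (x τ)) τ

/-- The derivative of `rhs` with respect to `x`. -/
def rhsDeriv (A G κ τ x : ℝ) : ℝ :=
  2 * A * sp τ * cp τ * sin x + (2 * G * sp τ ^ 2 - 2 * κ) * cos x

/-- The difference quotient of `rhs` between two functions. -/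
def coeff (A G κ : ℝ) (x y : ℝ → ℝ) (τ : ℝ) : ℝ :=
  sinc ((y τ - x τ) / 2) * rhsDeriv A G κ τ ((x τ + y τ) / 2)

lemma two_mul_sin_half (d : ℝ) : 2 * sin (d / 2) = d * sinc (d / 2) := by
  by_cases h : d = 0
  · simp [h]
  · rw [sinc_of_ne_zero (by positivity)]; field_simp

/-- The sum-to-product formulas make the factorization exact; writing it with `sinc` keeps the
coefficient continuous where `x` and `y` meet. The change of `G` is charged to `y`, so the
coefficient involves `G₁` alone. -/
lemma rhs_sub (A G₁ G₂ κ l₁ l₂ τ : ℝ) (x y : ℝ → ℝ) :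
    rhs A G₂ κ l₂ τ (y τ) - rhs A G₁ κ l₁ τ (x τ) =
      coeff A G₁ κ x y τ * (y τ - x τ)
        + 2 * sp τ * ((G₂ - G₁) * sp τ * sin (y τ) + (l₂ - l₁)) := by
  have h1 : cos (y τ) - cos (x τ) =
      -((y τ - x τ) * sinc ((y τ - x τ) / 2)) * sin ((x τ + y τ) / 2) := by
    rw [cos_sub_cos, ← two_mul_sin_half, add_comm (y τ)]; ring
  have h2 : sin (y τ) - sin (x τ) =
      ((y τ - x τ) * sinc ((y τ - x τ) / 2)) * cos ((x τ + y τ) / 2) := by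
    rw [sin_sub_sin, ← two_mul_sin_half, add_comm (y τ)]
  unfold rhs coeff rhsDeriv
  linear_combination (-2 * A * sp τ * cp τ) * h1 + (2 * G₁ * sp τ ^ 2 - 2 * κ) * h2

lemma abs_sp_mul_cp_le (τ : ℝ) : |sp τ * cp τ| ≤ sp τ := by
  rw [abs_mul, abs_of_pos (sp_pos τ)]
  exact mul_le_of_le_one_right (sp_pos τ).le (abs_cp_le_one τ)

lemma sp_sq_le (τ : ℝ) : sp τ ^ 2 ≤ sp τ := by
  nlinarith [sp_pos τ, sp_le_one τ]

/-- The `A` and `G` terms are `O(sp)`, hence negligible at both ends of time. The form with `u`, `v`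
serves `rhs` and its derivative in `x` alike. -/
lemma abs_perturbation_le (A G τ u v : ℝ) (hu : |u| ≤ 1) (hv : |v| ≤ 1) :
    |2 * A * (sp τ * cp τ) * u + 2 * G * sp τ ^ 2 * v| ≤ 2 * (|A| + |G|) * sp τ := by
  have h1 : |2 * A * (sp τ * cp τ) * u| ≤ 2 * |A| * sp τ := by
    rw [abs_mul, abs_mul, abs_mul, abs_two]
    calc 2 * |A| * |sp τ * cp τ| * |u| ≤ 2 * |A| * sp τ * 1 := by
          gcongr
          · have := sp_pos τ; positivity
          · exact abs_sp_mul_cp_le τ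
      _ = _ := mul_one _
  have h2 : |2 * G * sp τ ^ 2 * v| ≤ 2 * |G| * sp τ := by
    rw [abs_mul, abs_mul, abs_mul, abs_two, abs_of_nonneg (sq_nonneg (sp τ))]
    calc 2 * |G| * sp τ ^ 2 * |v| ≤ 2 * |G| * sp τ * 1 := by
          gcongr
          · have := sp_pos τ; positivity
          · exact sp_sq_le τ
      _ = _ := mul_one _
  calc _ ≤ _ := abs_add_le _ _
    _ ≤ 2 * |A| * sp τ + 2 * |G| * sp τ := add_le_add h1 h2
    _ = _ := by ring

lemma abs_rhs_add_le (A G κ l τ x : ℝ) :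
    |rhs A G κ l τ x + 2 * κ * sin x| ≤ 2 * (|A| + |G| + |l|) * sp τ := by
  have h := abs_perturbation_le A G τ (-cos x) (sin x)
    (by rw [abs_neg]; exact abs_cos_le_one x) (abs_sin_le_one x)
  have e : rhs A G κ l τ x + 2 * κ * sin x =
      (2 * A * (sp τ * cp τ) * (-cos x) + 2 * G * sp τ ^ 2 * sin x) + 2 * l * sp τ := by
    unfold rhs; ring
  have h3 : |2 * l * sp τ| = 2 * |l| * sp τ := by
    rw [abs_mul, abs_mul, abs_two, abs_of_pos (sp_pos τ)]
  rw [e]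
  refine (abs_add_le _ _).trans ?_
  rw [h3]; linarith

lemma abs_rhsDeriv_add_le (A G κ τ x : ℝ) :
    |rhsDeriv A G κ τ x + 2 * κ * cos x| ≤ 2 * (|A| + |G|) * sp τ := by
  have h := abs_perturbation_le A G τ (sin x) (cos x) (abs_sin_le_one x) (abs_cos_le_one x)
  convert h using 2
  unfold rhsDeriv; ring

lemma abs_rhs_le (A G κ l τ x : ℝ) :
    |rhs A G κ l τ x| ≤ 2 * (|A| + |G| + |l|) + 2 * |κ| := by
  have h := abs_rhs_add_le A G κ l τ x
  have h1 : |2 * κ * sin x| ≤ 2 * |κ| := by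
    rw [abs_mul, abs_mul, abs_two]
    exact mul_le_of_le_one_right (by positivity) (abs_sin_le_one x)
  have h2 : 2 * (|A| + |G| + |l|) * sp τ ≤ 2 * (|A| + |G| + |l|) :=
    mul_le_of_le_one_right (by positivity) (sp_le_one τ)
  have h3 := abs_sub_abs_le_abs_sub (rhs A G κ l τ x) (-(2 * κ * sin x))
  rw [sub_neg_eq_add, abs_neg] at h3
  linarith

lemma abs_rhsDeriv_le (A G κ τ x : ℝ) : |rhsDeriv A G κ τ x| ≤ 2 * (|A| + |G| + |κ|) := by
  have h := abs_rhsDeriv_add_le A G κ τ x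
  have h1 : |2 * κ * cos x| ≤ 2 * |κ| := by
    rw [abs_mul, abs_mul, abs_two]
    exact mul_le_of_le_one_right (by positivity) (abs_cos_le_one x)
  have h2 : 2 * (|A| + |G|) * sp τ ≤ 2 * (|A| + |G|) :=
    mul_le_of_le_one_right (by positivity) (sp_le_one τ)
  have h3 := abs_sub_abs_le_abs_sub (rhsDeriv A G κ τ x) (-(2 * κ * cos x))
  rw [sub_neg_eq_add, abs_neg] at h3
  linarith

lemma abs_coeff_le (A G κ : ℝ) (x y : ℝ → ℝ) (τ : ℝ) :
    |coeff A G κ x y τ| ≤ 2 * (|A| + |G| + |κ|) := by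
  unfold coeff
  rw [abs_mul]
  exact (mul_le_of_le_one_left (abs_nonneg _) (abs_sinc_le_one _)).trans
    (abs_rhsDeriv_le A G κ τ _)

lemma continuous_coeff (A G κ : ℝ) {x y : ℝ → ℝ} (hx : Continuous x) (hy : Continuous y) :
    Continuous (coeff A G κ x y) := by
  unfold coeff rhsDeriv
  have := continuous_sinc.comp ((hy.sub hx).div_const 2)
  simp only [Function.comp_def] at this
  fun_prop

lemma IsSol.continuous {A G κ l : ℝ} {x : ℝ → ℝ} (hx : IsSol A G κ l x) : Continuous x :=
  continuous_iff_continuousAt.2 fun τ => (hx τ).continuousAt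

/-! ### The integrating factor for the difference of two solutions -/

/-- The exponential of minus the primitive of the difference quotient. -/
def weight (A G κ : ℝ) (x y : ℝ → ℝ) (τ : ℝ) : ℝ := exp (-∫ σ in (0 : ℝ)..τ, coeff A G κ x y σ)

lemma weight_pos (A G κ : ℝ) (x y : ℝ → ℝ) (τ : ℝ) : 0 < weight A G κ x y τ := exp_pos _

lemma hasDerivAt_weight (A G κ : ℝ) {x y : ℝ → ℝ} (hx : Continuous x) (hy : Continuous y) (τ : ℝ) :
    HasDerivAt (weight A G κ x y) (weight A G κ x y τ * -coeff A G κ x y τ) τ :=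
  ((continuous_coeff A G κ hx hy).integral_hasStrictDerivAt 0 τ).hasDerivAt.neg.exp

lemma continuous_weight (A G κ : ℝ) {x y : ℝ → ℝ} (hx : Continuous x) (hy : Continuous y) :
    Continuous (weight A G κ x y) :=
  continuous_iff_continuousAt.2 fun τ => (hasDerivAt_weight A G κ hx hy τ).continuousAt

lemma abs_integral_coeff_le (A G κ : ℝ) (x y : ℝ → ℝ) (τ : ℝ) :
    |∫ σ in (0 : ℝ)..τ, coeff A G κ x y σ| ≤ 2 * (|A| + |G| + |κ|) * |τ| := by
  have := intervalIntegral.norm_integral_le_of_norm_le_const (a := 0) (b := τ)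
    (C := 2 * (|A| + |G| + |κ|)) (f := coeff A G κ x y) (fun σ _ => abs_coeff_le A G κ x y σ)
  simpa using this

lemma weight_le (A G κ : ℝ) (x y : ℝ → ℝ) (τ : ℝ) :
    weight A G κ x y τ ≤ exp (2 * (|A| + |G| + |κ|) * |τ|) :=
  exp_le_exp.2 ((neg_le_abs _).trans (abs_integral_coeff_le A G κ x y τ))

lemma le_weight (A G κ : ℝ) (x y : ℝ → ℝ) (τ : ℝ) :
    exp (-(2 * (|A| + |G| + |κ|) * |τ|)) ≤ weight A G κ x y τ :=
  exp_le_exp.2 (neg_le_neg ((le_abs_self _).trans (abs_integral_coeff_le A G κ x y τ)))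

/-- The inhomogeneity of the linear equation for the difference of two solutions. -/
def source (y : ℝ → ℝ) (g d τ : ℝ) : ℝ := 2 * sp τ * (g * sp τ * sin (y τ) + d)

lemma abs_source_le (y : ℝ → ℝ) (g d τ : ℝ) : |source y g d τ| ≤ 2 * (|g| + |d|) := by
  unfold source
  have h : |g * sp τ * sin (y τ)| ≤ |g| := by
    rw [abs_mul, abs_mul, abs_of_pos (sp_pos τ), mul_assoc]
    exact mul_le_of_le_one_right (abs_nonneg _)
      (mul_le_one₀ (sp_le_one τ) (abs_nonneg _) (abs_sin_le_one _))
  rw [abs_mul, abs_mul, abs_two, abs_of_pos (sp_pos τ)]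
  calc 2 * sp τ * |g * sp τ * sin (y τ) + d| ≤ 2 * 1 * (|g| + |d|) := by
        gcongr
        · exact sp_le_one τ
        · exact (abs_add_le _ _).trans (by linarith)
    _ = _ := by ring

lemma continuous_source {y : ℝ → ℝ} (hy : Continuous y) (g d : ℝ) : Continuous (source y g d) := by
  unfold source; fun_prop

lemma hasDerivAt_sub_mul_weight {A G₁ G₂ κ l₁ l₂ : ℝ} {x y : ℝ → ℝ} (hx : IsSol A G₁ κ l₁ x)
    (hy : IsSol A G₂ κ l₂ y) (τ : ℝ) :
    HasDerivAt (fun τ => (y τ - x τ) * weight A G₁ κ x y τ)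
      (weight A G₁ κ x y τ * source y (G₂ - G₁) (l₂ - l₁) τ) τ := by
  have h := ((hy τ).sub (hx τ)).mul (hasDerivAt_weight A G₁ κ hx.continuous hy.continuous τ)
  refine h.congr_deriv ?_
  rw [rhs_sub, source, Pi.sub_apply]; ring

/-- Continuous dependence on the initial value and the parameters. -/
lemma abs_sub_le_of_isSol {A G₁ G₂ κ l₁ l₂ : ℝ} {x y : ℝ → ℝ} (hx : IsSol A G₁ κ l₁ x)
    (hy : IsSol A G₂ κ l₂ y) (t₀ t : ℝ) :
    |y t - x t| ≤ exp (2 * (|A| + |G₁| + |κ|) * (|t| + max |t| |t₀|)) *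
      (|y t₀ - x t₀| + 2 * (|G₂ - G₁| + |l₂ - l₁|) * |t - t₀|) := by
  set L := 2 * (|A| + |G₁| + |κ|)
  set w := weight A G₁ κ x y
  set f := source y (G₂ - G₁) (l₂ - l₁)
  set M := max |t| |t₀|
  have hL : 0 ≤ L := by positivity
  have hw : Continuous w := continuous_weight A G₁ κ hx.continuous hy.continuous
  have hf : Continuous f := continuous_source hy.continuous _ _
  have hI : ∫ σ in t₀..t, w σ * f σ = (y t - x t) * w t - (y t₀ - x t₀) * w t₀ :=
    intervalIntegral.integral_eq_sub_of_hasDerivAt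
      (fun σ _ => hasDerivAt_sub_mul_weight hx hy σ) ((hw.mul hf).intervalIntegrable _ _)
  have hb : ∀ σ ∈ Set.uIoc t₀ t, ‖w σ * f σ‖ ≤ exp (L * M) * (2 * (|G₂ - G₁| + |l₂ - l₁|)) := by
    intro σ hσ
    have hσM : |σ| ≤ M := by
      have := Set.uIoc_subset_uIcc hσ
      rcases Set.mem_uIcc.1 this with h | h <;> simp only [M, le_max_iff] <;>
        grind
    rw [norm_mul, Real.norm_eq_abs, Real.norm_eq_abs, abs_of_pos (weight_pos _ _ _ _ _ _)]
    gcongr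
    · exact (weight_le A G₁ κ x y σ).trans (exp_le_exp.2 (by gcongr))
    · exact abs_source_le _ _ _ _
  have h1 := intervalIntegral.norm_integral_le_of_norm_le_const hb
  rw [hI, Real.norm_eq_abs] at h1
  have h2 : |y t - x t| * w t ≤ exp (L * M) *
      (|y t₀ - x t₀| + 2 * (|G₂ - G₁| + |l₂ - l₁|) * |t - t₀|) := by
    have h3 := abs_sub_abs_le_abs_sub ((y t - x t) * w t) ((y t₀ - x t₀) * w t₀)
    rw [abs_mul, abs_mul, abs_of_pos (weight_pos A G₁ κ x y t),
      abs_of_pos (weight_pos A G₁ κ x y t₀)] at h3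
    have h4 : w t₀ ≤ exp (L * M) :=
      (weight_le A G₁ κ x y t₀).trans (exp_le_exp.2 (by gcongr; exact le_max_right _ _))
    have h5 := mul_le_mul_of_nonneg_left h4 (abs_nonneg (y t₀ - x t₀))
    nlinarith
  -- Dividing out the weight at `t` costs the factor `exp (L * |t|)`; the factor `exp (L * M)`
  -- bounds the weight between `t₀` and `t`.
  have h6 : 1 ≤ exp (L * |t|) * w t := by
    have := mul_le_mul_of_nonneg_left (le_weight A G₁ κ x y t) (exp_pos (L * |t|)).le
    rwa [← exp_add, add_neg_cancel, exp_zero] at this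
  calc |y t - x t| ≤ |y t - x t| * (exp (L * |t|) * w t) :=
        le_mul_of_one_le_right (abs_nonneg _) h6
    _ = exp (L * |t|) * (|y t - x t| * w t) := by ring
    _ ≤ exp (L * |t|) * (exp (L * M) *
      (|y t₀ - x t₀| + 2 * (|G₂ - G₁| + |l₂ - l₁|) * |t - t₀|)) := by gcongr
    _ = _ := by rw [mul_add L, exp_add]; ring

/-! ### Existence of solutions -/

/-- A bounded, uniformly Lipschitz, time-dependent vector field on `ℝ` has global solutions. -/
lemma exists_global_solution {v : ℝ → ℝ → ℝ} {K : NNReal} {C : ℝ}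
    (hv : ∀ t, LipschitzWith K (v t)) (hc : ∀ x, Continuous fun t => v t x)
    (hb : ∀ t x, |v t x| ≤ C) (t₀ x₀ : ℝ) :
    ∃ x : ℝ → ℝ, x t₀ = x₀ ∧ ∀ t, HasDerivAt x (v t (x t)) t := by
  have hC : 0 ≤ C := (abs_nonneg _).trans (hb 0 0)
  have key : ∀ n : ℕ, ∃ α : ℝ → ℝ, α t₀ = x₀ ∧
      ∀ t, |t - t₀| < n + 1 → HasDerivAt α (v t (α t)) t := by
    intro n
    have hn : (0 : ℝ) < n + 1 := by positivity
    -- Speed at most `C` keeps the curve within `C * (n + 1)` of `x₀`, so the interval of existence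
    -- need not be small.
    have hpl : IsPicardLindelof v (tmin := t₀ - (n + 1)) (tmax := t₀ + (n + 1))
        ⟨t₀, by constructor <;> linarith⟩ x₀ (C.toNNReal * (n + 1)) 0 C.toNNReal K := by
      refine ⟨fun t _ => (hv t).lipschitzOnWith, fun x _ => (hc x).continuousOn,
        fun t _ x _ => ?_, ?_⟩
      · rw [Real.coe_toNNReal _ hC]; exact hb t x
      · simp
    obtain ⟨α, h0, h⟩ := hpl.exists_eq_forall_mem_Icc_hasDerivWithinAt₀
    refine ⟨α, h0, fun t ht => ?_⟩
    rw [abs_lt] at ht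
    exact (h t ⟨by linarith, by linarith⟩).hasDerivAt
      (Icc_mem_nhds (by linarith) (by linarith))
  choose α h0 hα using key
  have agree : ∀ (m n : ℕ) (t : ℝ), |t - t₀| < m + 1 → |t - t₀| < n + 1 → α m t = α n t := by
    intro m n t hm hn
    have hr : |t - t₀| < min (m + 1 : ℝ) (n + 1) := lt_min hm hn
    have hr0 : 0 < min (m + 1 : ℝ) (n + 1) := (abs_nonneg _).trans_lt hr
    have mem : ∀ u ∈ Ioo (t₀ - min (m + 1 : ℝ) (n + 1)) (t₀ + min (m + 1 : ℝ) (n + 1)),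
        |u - t₀| < m + 1 ∧ |u - t₀| < n + 1 := by
      intro u hu
      rw [← lt_min_iff, abs_lt]
      exact ⟨by linarith [hu.1], by linarith [hu.2]⟩
    rw [abs_lt] at hr
    exact ODE_solution_unique_of_mem_Ioo (s := fun _ => univ) (K := K) (v := v)
      (fun u _ => (hv u).lipschitzOnWith) (t₀ := t₀) ⟨by linarith, by linarith⟩
      (fun u hu => ⟨hα m u (mem u hu).1, mem_univ _⟩)
      (fun u hu => ⟨hα n u (mem u hu).2, mem_univ _⟩) ((h0 m).trans (h0 n).symm)
      ⟨by linarith, by linarith⟩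
  -- The `n`-th local solution lives on radius `n + 1`, so this index leaves room to use a single
  -- local solution near `t`.
  refine ⟨fun t => α ⌈|t - t₀|⌉₊ t, h0 _, fun t => ?_⟩
  have ht : |t - t₀| < (⌈|t - t₀|⌉₊ : ℝ) + 1 := (Nat.le_ceil _).trans_lt (lt_add_one _)
  refine (hα ⌈|t - t₀|⌉₊ t ht).congr_of_eventuallyEq ?_
  have hcont : Continuous fun u : ℝ => |u - t₀| := by fun_prop
  filter_upwards [hcont.continuousAt.eventually (gt_mem_nhds ht)] with u hu
  exact agree _ _ u ((Nat.le_ceil _).trans_lt (lt_add_one _)) hu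

lemma exists_isSol (A G κ l t₀ x₀ : ℝ) : ∃ x : ℝ → ℝ, x t₀ = x₀ ∧ IsSol A G κ l x := by
  refine exists_global_solution (v := rhs A G κ l) (K := (2 * (|A| + |G| + |κ|)).toNNReal)
    (fun t => LipschitzWith.of_dist_le_mul fun x y => ?_) (fun x => ?_)
    (abs_rhs_le A G κ l) t₀ x₀
  · rw [Real.coe_toNNReal _ (by positivity), Real.dist_eq, Real.dist_eq]
    have := rhs_sub A G G κ l l t (fun _ => y) (fun _ => x)
    simp only [sub_self, zero_mul, add_zero, mul_zero] at this
    rw [this, abs_mul]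
    gcongr
    exact abs_coeff_le _ _ _ _ _ _
  · unfold rhs; fun_prop

/-! ### Barriers and connectors -/

/-- A level at which the field points down cannot be crossed upwards. -/
lemma IsSol.le_of_rhs_neg {A G κ l : ℝ} {x : ℝ → ℝ} (hx : IsSol A G κ l x) {t₀ t₁ y : ℝ}
    (h0 : x t₀ ≤ y) (hy : ∀ τ ∈ Ico t₀ t₁, rhs A G κ l τ y < 0) : ∀ τ ∈ Icc t₀ t₁, x τ ≤ y :=
  image_le_of_deriv_right_lt_deriv_boundary' (B := fun _ => y) (B' := fun _ => 0)
    hx.continuous.continuousOn (fun τ _ => (hx τ).hasDerivWithinAt) h0 continuousOn_const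
    (fun _ _ => hasDerivWithinAt_const _ _ _) (fun _ hτ h => h ▸ hy _ hτ)

lemma IsSol.le_of_rhs_pos {A G κ l : ℝ} {x : ℝ → ℝ} (hx : IsSol A G κ l x) {t₀ t₁ y : ℝ}
    (h0 : y ≤ x t₀) (hy : ∀ τ ∈ Ico t₀ t₁, 0 < rhs A G κ l τ y) : ∀ τ ∈ Icc t₀ t₁, y ≤ x τ :=
  image_le_of_deriv_right_lt_deriv_boundary' (f := fun _ => y) (f' := fun _ => 0)
    continuousOn_const (fun _ _ => hasDerivWithinAt_const _ _ _) h0 hx.continuous.continuousOn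
    (fun τ _ => (hx τ).hasDerivWithinAt) (fun _ hτ h => h ▸ hy _ hτ)

/-- The limit at `+∞` of a connector of winding number `N`. -/
def target (N : ℤ) : ℝ := -π - 2 * π * N

/-- Scalar saddles connectors of winding number `N`. -/
structure IsConn (A G κ l : ℝ) (N : ℤ) (x : ℝ → ℝ) : Prop where
  isSol : IsSol A G κ l x
  tendsto_atBot : Tendsto x atBot (𝓝 0)
  tendsto_atTop : Tendsto x atTop (𝓝 (target N))

lemma cos_sub_target (N : ℤ) (x : ℝ) : cos (x - target N) = -cos x := by
  rw [target, show x - (-π - 2 * π * N) = (x + π) + N * (2 * π) by ring, cos_add_int_mul_two_pi,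
    cos_add_pi]

lemma sin_sub_target (N : ℤ) (x : ℝ) : sin (x - target N) = -sin x := by
  rw [target, show x - (-π - 2 * π * N) = (x + π) + N * (2 * π) by ring, sin_add_int_mul_two_pi,
    sin_add_pi]

lemma target_reflect (N : ℤ) : target (-N - 1) = -target N := by
  unfold target; push_cast; ring

/-- Time reversal combined with a translation preserves the form of the scalar equation. -/
lemma IsSol.reflect {A G κ l : ℝ} {x : ℝ → ℝ} (hx : IsSol A G κ l x) (N : ℤ) :
    IsSol (-A) G κ (-l) (fun τ => x (-τ) - target N) := by
  intro τ
  have h := ((hx (-τ)).comp τ (hasDerivAt_neg τ)).sub_const (target N)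
  refine h.congr_deriv ?_
  simp only [rhs, sp_neg, cp_neg, cos_sub_target, sin_sub_target]
  ring

/-- Exchanges the two ends, so every estimate at the right saddle follows from one at the left. -/
lemma IsConn.reflect {A G κ l : ℝ} {N : ℤ} {x : ℝ → ℝ} (hx : IsConn A G κ l N x) :
    IsConn (-A) G κ (-l) (-N - 1) (fun τ => x (-τ) - target N) := by
  refine ⟨hx.isSol.reflect N, ?_, ?_⟩
  · simpa using (hx.tendsto_atTop.comp tendsto_neg_atBot_atTop).sub_const (target N)
  · rw [target_reflect]
    simpa using (hx.tendsto_atBot.comp tendsto_neg_atTop_atBot).sub_const (target N)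

/-- Small intervals around the left saddle are forward invariant at large negative times. -/
lemma exists_time_forall_abs_le (A κ R ε : ℝ) (hκ : 0 < κ) (hε : 0 < ε) (hε' : ε ≤ 1) :
    ∃ T : ℝ, 0 < T ∧ ∀ G l x, |G| ≤ R → |l| ≤ R → IsSol A G κ l x →
      ∀ t₀ τ, t₀ ≤ τ → τ ≤ -T → |x t₀| ≤ ε → |x τ| ≤ ε := by
  have hsin : 0 < sin ε := sin_pos_of_pos_of_lt_pi hε (by linarith [pi_gt_three])
  -- This bound on `sp` makes the perturbation smaller than the restoring term `2 κ sin ε` at the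
  -- levels `±ε`.
  obtain ⟨T, hT, h⟩ := exists_sp_lt (η := κ * sin ε / (|A| + |R| + |R| + 1)) (by positivity)
  refine ⟨T, hT, fun G l x hG hl hx t₀ τ h0 hτ hx0 => ?_⟩
  have key : ∀ σ ∈ Ico t₀ τ, 2 * (|A| + |G| + |l|) * sp σ < 2 * κ * sin ε := by
    intro σ hσ
    have h1 := h σ (by rw [abs_of_neg (by linarith [hσ.2])]; linarith [hσ.2])
    rw [lt_div_iff₀ (by positivity)] at h1
    have h2 : (|A| + |G| + |l|) * sp σ ≤ (|A| + |R| + |R| + 1) * sp σ := by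
      have := (sp_pos σ).le
      have h3 := hG.trans (le_abs_self R)
      have h4 := hl.trans (le_abs_self R)
      gcongr ?_ * _
      linarith
    linarith
  have hx0' := abs_le.1 hx0
  rw [abs_le]
  constructor
  · refine hx.le_of_rhs_pos hx0'.1 (fun σ hσ => ?_) τ ⟨h0, le_rfl⟩
    have h1 := (abs_le.1 (abs_rhs_add_le A G κ l σ (-ε))).1
    rw [sin_neg] at h1
    linarith [key σ hσ]
  · refine hx.le_of_rhs_neg hx0'.2 (fun σ hσ => ?_) τ ⟨h0, le_rfl⟩
    have h1 := (abs_le.1 (abs_rhs_add_le A G κ l σ ε)).2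
    linarith [key σ hσ]

/-- A connector tends to `0` at `-∞`, so it is inside the invariant interval at arbitrarily early
times. The time `T` does not depend on the connector, and this uniformity is what later limits need.
-/
lemma exists_time_forall_conn_left (A κ R ε : ℝ) (hκ : 0 < κ) (hε : 0 < ε) (hε' : ε ≤ 1) :
    ∃ T : ℝ, 0 < T ∧ ∀ G l N x, |G| ≤ R → |l| ≤ R → IsConn A G κ l N x →
      ∀ τ ≤ -T, |x τ| ≤ ε := by
  obtain ⟨T, hT, h⟩ := exists_time_forall_abs_le A κ R ε hκ hε hε'
  refine ⟨T, hT, fun G l N x hG hl hx τ hτ => ?_⟩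
  have h1 : ∀ᶠ t in atBot, |x t| < ε := by
    have := hx.tendsto_atBot.abs
    rw [abs_zero] at this
    exact this.eventually (gt_mem_nhds hε)
  obtain ⟨t, ht, ht'⟩ := (h1.and (eventually_le_atBot τ)).exists
  exact h G l x hG hl hx.isSol t τ ht' hτ ht.le

lemma exists_time_forall_conn (A κ R ε : ℝ) (hκ : 0 < κ) (hε : 0 < ε) (hε' : ε ≤ 1) :
    ∃ T : ℝ, 0 < T ∧ ∀ G l N x, |G| ≤ R → |l| ≤ R → IsConn A G κ l N x →
      (∀ τ ≤ -T, |x τ| ≤ ε) ∧ ∀ τ, T ≤ τ → |x τ - target N| ≤ ε := by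
  obtain ⟨T₁, hT₁, h₁⟩ := exists_time_forall_conn_left A κ R ε hκ hε hε'
  obtain ⟨T₂, hT₂, h₂⟩ := exists_time_forall_conn_left (-A) κ R ε hκ hε hε'
  refine ⟨max T₁ T₂, lt_max_of_lt_left hT₁, fun G l N x hG hl hx => ⟨fun τ hτ => ?_, fun τ hτ => ?_⟩⟩
  · exact h₁ G l N x hG hl hx τ (by linarith [le_max_left T₁ T₂])
  · have := h₂ G (-l) _ _ hG (by rwa [abs_neg]) hx.reflect (-τ) (by linarith [le_max_right T₁ T₂])
    simpa using this

/-! ### Exponential decay of the weight along connectors -/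

/-- Jordan's inequality `sin v ≥ 2 v / π` together with `π ≤ 4`. -/
lemma half_le_sinc {u : ℝ} (hu : |u| ≤ 1) : 1 / 2 ≤ sinc u := by
  have key : ∀ v : ℝ, 0 ≤ v → v ≤ 1 → 1 / 2 ≤ sinc v := by
    intro v h0 h1
    rcases h0.eq_or_lt with rfl | h0
    · norm_num
    · rw [sinc_of_ne_zero h0.ne', le_div_iff₀ h0]
      refine le_trans ?_ (mul_le_sin h0.le (by linarith [pi_gt_three]))
      gcongr ?_ * _
      rw [div_le_div_iff₀ two_pos pi_pos]
      linarith [pi_le_four]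
  rcases abs_cases u with ⟨h, h'⟩ | ⟨h, h'⟩
  · exact key u h' (h ▸ hu)
  · rw [← sinc_neg]; exact key (-u) (by linarith) (h ▸ hu)

lemma seven_eighths_le_cos {m : ℝ} (hm : |m| ≤ 1 / 2) : 7 / 8 ≤ cos m := by
  have := one_sub_sq_div_two_le_cos (x := m)
  have h := sq_le_sq' (abs_le.1 hm).1 (abs_le.1 hm).2
  linarith

lemma coeff_le {A G κ τ : ℝ} {x y : ℝ → ℝ} (hs : 2 * (|A| + |G|) * sp τ ≤ κ / 4)
    (hx : |x τ| ≤ 1 / 2) (hy : |y τ| ≤ 1 / 2) : coeff A G κ x y τ ≤ -(κ / 2) := by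
  have hκ : 0 ≤ κ := by
    have := sp_pos τ
    have : 0 ≤ 2 * (|A| + |G|) * sp τ := by positivity
    linarith
  rw [abs_le] at hx hy
  have h1 := half_le_sinc (u := (y τ - x τ) / 2) (abs_le.2 ⟨by linarith, by linarith⟩)
  have h2 := seven_eighths_le_cos (m := (x τ + y τ) / 2) (abs_le.2 ⟨by linarith, by linarith⟩)
  have h3 := (abs_le.1 (abs_rhsDeriv_add_le A G κ τ ((x τ + y τ) / 2))).2
  -- Indeed `-2κ · 7/8 + κ/4 ≤ -κ`; the factor `sinc ≥ 1/2` then leaves `-κ/2`.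
  have h4 : rhsDeriv A G κ τ ((x τ + y τ) / 2) ≤ -κ := by nlinarith
  unfold coeff
  nlinarith

/-- The sign is opposite to that at the left saddle because the cosine is `-1` at the target. -/
lemma le_coeff {A G κ τ : ℝ} {N : ℤ} {x y : ℝ → ℝ} (hs : 2 * (|A| + |G|) * sp τ ≤ κ / 4)
    (hx : |x τ - target N| ≤ 1 / 2) (hy : |y τ - target N| ≤ 1 / 2) :
    κ / 2 ≤ coeff A G κ x y τ := by
  have hκ : 0 ≤ κ := by
    have := sp_pos τ
    have : 0 ≤ 2 * (|A| + |G|) * sp τ := by positivity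
    linarith
  rw [abs_le] at hx hy
  have h1 := half_le_sinc (u := (y τ - x τ) / 2) (abs_le.2 ⟨by linarith, by linarith⟩)
  have h2 := seven_eighths_le_cos (m := (x τ + y τ) / 2 - target N)
    (abs_le.2 ⟨by linarith, by linarith⟩)
  rw [cos_sub_target] at h2
  have h3 := (abs_le.1 (abs_rhsDeriv_add_le A G κ τ ((x τ + y τ) / 2))).1
  have h4 : κ ≤ rhsDeriv A G κ τ ((x τ + y τ) / 2) := by nlinarith
  unfold coeff
  nlinarith

/-- The primitive of a function which is large at both ends. -/
lemma le_integral_of_le {b : ℝ → ℝ} (hb : Continuous b) {L T c : ℝ} (hT : 0 ≤ T) (hc : 0 ≤ c)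
    (hL : 0 ≤ L) (hbL : ∀ σ, |b σ| ≤ L) (hr : ∀ σ, T ≤ σ → c ≤ b σ) {τ : ℝ} (hτ : 0 ≤ τ) :
    c * τ - (L + c) * T ≤ ∫ σ in (0 : ℝ)..τ, b σ := by
  have h1 : ∀ u, 0 ≤ u → -(L * u) ≤ ∫ σ in (0 : ℝ)..u, b σ := by
    intro u hu
    have := intervalIntegral.norm_integral_le_of_norm_le_const (a := 0) (b := u)
      (C := L) (f := b) (fun σ _ => hbL σ)
    rw [sub_zero, abs_of_nonneg hu] at this
    exact (abs_le.1 this).1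
  rcases le_total τ T with h | h
  · have := h1 τ hτ
    nlinarith
  · have h2 : c * (τ - T) ≤ ∫ σ in T..τ, b σ := by
      have := intervalIntegral.integral_mono_on (f := fun _ => c) (g := b) h
        (intervalIntegrable_const (μ := volume)) (hb.intervalIntegrable _ _) (fun σ hσ => hr σ hσ.1)
      simpa [mul_comm] using this
    rw [← intervalIntegral.integral_add_adjacent_intervals
      (hb.intervalIntegrable 0 T) (hb.intervalIntegrable T τ)]
    have := h1 T hT
    nlinarith

lemma le_integral_of_le_of_le {b : ℝ → ℝ} (hb : Continuous b) {L T c : ℝ} (hT : 0 ≤ T)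
    (hc : 0 ≤ c) (hL : 0 ≤ L) (hbL : ∀ σ, |b σ| ≤ L) (hl : ∀ σ ≤ -T, b σ ≤ -c)
    (hr : ∀ σ, T ≤ σ → c ≤ b σ) (τ : ℝ) :
    c * |τ| - (L + c) * T ≤ ∫ σ in (0 : ℝ)..τ, b σ := by
  rcases le_total 0 τ with h | h
  · rw [abs_of_nonneg h]
    exact le_integral_of_le hb hT hc hL hbL hr h
  · rw [abs_of_nonpos h]
    have := le_integral_of_le (b := fun σ => -b (-σ)) (by fun_prop) hT hc hL
      (fun σ => by rw [abs_neg]; exact hbL _)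
      (fun σ hσ => by have := hl (-σ) (by linarith); linarith) (neg_nonneg.2 h)
    rwa [intervalIntegral.integral_neg, intervalIntegral.integral_comp_neg, neg_neg, neg_zero,
      intervalIntegral.integral_symm, neg_neg] at this

/-- Uniform exponential decay of the weight attached to two connectors. -/
lemma exists_weight_le (A κ R : ℝ) (hκ : 0 < κ) :
    ∃ C : ℝ, 0 < C ∧ ∀ N G₁ G₂ l₁ l₂ x y, |G₁| ≤ R → |G₂| ≤ R → |l₁| ≤ R → |l₂| ≤ R →
      IsConn A G₁ κ l₁ N x → IsConn A G₂ κ l₂ N y →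
        ∀ τ, weight A G₁ κ x y τ ≤ C * exp (-(κ / 2) * |τ|) := by
  obtain ⟨T₁, hT₁, h₁⟩ := exists_time_forall_conn A κ R (1 / 2) hκ (by norm_num) (by norm_num)
  obtain ⟨T₂, hT₂, h₂⟩ := exists_sp_lt (η := κ / 4 / (2 * (|A| + |R|) + 1)) (by positivity)
  set T := max T₁ T₂
  have hT : 0 < T := lt_max_of_lt_left hT₁
  -- Between `-T` and `T` only the crude bound on the coefficient is available; the constant pays
  -- for that.
  refine ⟨exp ((2 * (|A| + |R| + |κ|) + κ / 2) * T), exp_pos _, ?_⟩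
  intro N G₁ G₂ l₁ l₂ x y hG₁ hG₂ hl₁ hl₂ hx hy τ
  have hR := hG₁.trans (le_abs_self R)
  have hs : ∀ σ, T ≤ |σ| → 2 * (|A| + |G₁|) * sp σ ≤ κ / 4 := by
    intro σ hσ
    have h3 := h₂ σ ((le_max_right _ _).trans hσ)
    rw [lt_div_iff₀ (by positivity)] at h3
    have h4 : (2 * (|A| + |G₁|)) * sp σ ≤ (2 * (|A| + |R|) + 1) * sp σ := by
      have := (sp_pos σ).le
      gcongr ?_ * _
      linarith
    linarith
  have h1x := h₁ G₁ l₁ N x hG₁ hl₁ hx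
  have h1y := h₁ G₂ l₂ N y hG₂ hl₂ hy
  have h5 := le_integral_of_le_of_le
    (continuous_coeff A G₁ κ hx.isSol.continuous hy.isSol.continuous) (T := T) (c := κ / 2)
    (L := 2 * (|A| + |R| + |κ|)) hT.le (by positivity) (by positivity)
    (fun σ => (abs_coeff_le A G₁ κ x y σ).trans (by gcongr))
    (fun σ hσ => coeff_le (hs σ (by rw [abs_of_neg (by linarith)]; linarith))
      (h1x.1 σ (by linarith [le_max_left T₁ T₂])) (h1y.1 σ (by linarith [le_max_left T₁ T₂])))
    (fun σ hσ => le_coeff (hs σ (by rw [abs_of_pos (by linarith)]; linarith))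
      (h1x.2 σ (by linarith [le_max_left T₁ T₂])) (h1y.2 σ (by linarith [le_max_left T₁ T₂])))
    τ
  rw [weight, ← exp_add]
  apply exp_le_exp.2
  linarith

lemma integrable_exp_neg_mul_abs {c : ℝ} (hc : 0 < c) :
    Integrable fun τ : ℝ => exp (-c * |τ|) := by
  rw [← integrableOn_univ, ← Set.Iic_union_Ioi (a := (0 : ℝ))]
  refine IntegrableOn.union ?_ ?_
  · refine (integrableOn_exp_mul_Iic hc 0).congr_fun (fun τ hτ => ?_) measurableSet_Iic
    simp only [abs_of_nonpos (mem_Iic.1 hτ)]; ring_nf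
  · refine (integrableOn_exp_mul_Ioi (neg_lt_zero.2 hc) 0).congr_fun (fun τ hτ => ?_)
      measurableSet_Ioi
    simp only [abs_of_pos (mem_Ioi.1 hτ)]

/-! ### Comparison of two connectors with the same winding number -/

section Pair

variable {A κ G₁ G₂ l₁ l₂ : ℝ} {N : ℤ} {x y : ℝ → ℝ}

lemma integrable_weight (hκ : 0 < κ) (hx : IsConn A G₁ κ l₁ N x) (hy : IsConn A G₂ κ l₂ N y) :
    Integrable (weight A G₁ κ x y) := by
  set R := max (max |G₁| |G₂|) (max |l₁| |l₂|)
  obtain ⟨C, hC, h⟩ := exists_weight_le A κ R hκ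
  refine ((integrable_exp_neg_mul_abs (half_pos hκ)).const_mul C).mono'
    (continuous_weight A G₁ κ hx.isSol.continuous hy.isSol.continuous).aestronglyMeasurable
    (Eventually.of_forall fun τ => ?_)
  rw [Real.norm_eq_abs, abs_of_pos (weight_pos _ _ _ _ _ _)]
  exact h N G₁ G₂ l₁ l₂ x y (by simp [R]) (by simp [R]) (by simp [R]) (by simp [R]) hx hy τ

lemma integrable_weight_mul (hκ : 0 < κ) (hx : IsConn A G₁ κ l₁ N x)
    (hy : IsConn A G₂ κ l₂ N y) {f : ℝ → ℝ} (hf : Continuous f) {C : ℝ} (hC : ∀ τ, |f τ| ≤ C) :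
    Integrable fun τ => weight A G₁ κ x y τ * f τ :=
  (integrable_weight hκ hx hy).mul_bdd hf.aestronglyMeasurable (Eventually.of_forall hC)

/-- The weighted integral in the denominator of the slope of the parameter. -/
def den (A G₁ κ : ℝ) (x y : ℝ → ℝ) : ℝ := ∫ τ, weight A G₁ κ x y τ * sp τ

/-- The weighted integral in the numerator of the slope of the parameter. -/
def num (A G₁ κ : ℝ) (x y : ℝ → ℝ) : ℝ := ∫ τ, weight A G₁ κ x y τ * (sp τ ^ 2 * sin (y τ))

lemma abs_sp_le_one (τ : ℝ) : |sp τ| ≤ 1 := by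
  rw [abs_of_pos (sp_pos τ)]; exact sp_le_one τ

lemma abs_sp_sq_mul_sin_le (τ u : ℝ) : |sp τ ^ 2 * sin u| ≤ sp τ ^ 2 := by
  rw [abs_mul, abs_of_nonneg (sq_nonneg (sp τ))]
  exact mul_le_of_le_one_right (sq_nonneg _) (abs_sin_le_one u)

lemma sp_sq_le_one (τ : ℝ) : sp τ ^ 2 ≤ 1 := (sp_sq_le τ).trans (sp_le_one τ)

lemma abs_num_lt_den (hκ : 0 < κ) (hx : IsConn A G₁ κ l₁ N x) (hy : IsConn A G₂ κ l₂ N y) :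
    |num A G₁ κ x y| < den A G₁ κ x y := by
  have hsq : ∀ τ, |sp τ ^ 2| ≤ 1 := fun τ => by
    rw [abs_of_nonneg (sq_nonneg (sp τ))]; exact sp_sq_le_one τ
  have hi1 := integrable_weight_mul hκ hx hy (f := sp) (by fun_prop) abs_sp_le_one
  have hi2 := integrable_weight_mul hκ hx hy (f := fun τ => sp τ ^ 2) (by fun_prop) hsq
  have h1 : |num A G₁ κ x y| ≤ ∫ τ, weight A G₁ κ x y τ * sp τ ^ 2 := by
    rw [num, ← Real.norm_eq_abs]
    refine norm_integral_le_of_norm_le hi2 (Eventually.of_forall fun τ => ?_)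
    rw [norm_mul, Real.norm_eq_abs, Real.norm_eq_abs, abs_of_pos (weight_pos _ _ _ _ _ _)]
    exact mul_le_mul_of_nonneg_left (abs_sp_sq_mul_sin_le _ _) (weight_pos _ _ _ _ _ _).le
  refine h1.trans_lt (sub_pos.1 ?_)
  rw [den, ← integral_sub hi1 hi2]
  have hw := continuous_weight A G₁ κ hx.isSol.continuous hy.isSol.continuous
  -- The point `0` would not do: `sp 0 = 1`, and the difference of the integrands vanishes there.
  refine integral_pos_of_integrable_nonneg_nonzero (x := 1) (by fun_prop) (hi1.sub hi2)
    (fun τ => ?_) ?_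
  · rw [Pi.zero_apply, ← mul_sub]
    exact mul_nonneg (weight_pos _ _ _ _ _ _).le (sub_nonneg.2 (sp_sq_le τ))
  · rw [← mul_sub]
    refine mul_ne_zero (weight_pos _ _ _ _ _ _).ne' ?_
    nlinarith [sp_pos 1, sp_one_lt_one]

lemma den_pos (hκ : 0 < κ) (hx : IsConn A G₁ κ l₁ N x) (hy : IsConn A G₂ κ l₂ N y) :
    0 < den A G₁ κ x y := (abs_nonneg _).trans_lt (abs_num_lt_den hκ hx hy)

lemma tendsto_sub_mul_weight (hκ : 0 < κ) (hx : IsConn A G₁ κ l₁ N x)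
    (hy : IsConn A G₂ κ l₂ N y) {f : Filter ℝ} {e : ℝ} (h1 : Tendsto x f (𝓝 e))
    (h2 : Tendsto y f (𝓝 e)) :
    Tendsto (fun τ => (y τ - x τ) * weight A G₁ κ x y τ) f (𝓝 0) := by
  obtain ⟨C, hC, h⟩ := exists_weight_le A κ (max (max |G₁| |G₂|) (max |l₁| |l₂|)) hκ
  have h3 := ((h2.sub h1).abs).mul_const C
  rw [sub_self, abs_zero, zero_mul] at h3
  refine squeeze_zero_norm (fun τ => ?_) h3
  rw [norm_mul, Real.norm_eq_abs, Real.norm_eq_abs, abs_of_pos (weight_pos _ _ _ _ _ _)]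
  gcongr
  refine (h N G₁ G₂ l₁ l₂ x y (by simp) (by simp) (by simp) (by simp) hx hy τ).trans ?_
  refine mul_le_of_le_one_right hC.le (exp_le_one_iff.2 ?_)
  have := abs_nonneg τ
  nlinarith

lemma integrable_weight_mul_source (hκ : 0 < κ) (hx : IsConn A G₁ κ l₁ N x)
    (hy : IsConn A G₂ κ l₂ N y) (g d : ℝ) :
    Integrable fun τ => weight A G₁ κ x y τ * source y g d τ :=
  integrable_weight_mul hκ hx hy (continuous_source hy.isSol.continuous g d) (abs_source_le y g d)

/-- The parameters of two connectors differ by a weighted mean. -/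
lemma sub_mul_den_eq (hκ : 0 < κ) (hx : IsConn A G₁ κ l₁ N x) (hy : IsConn A G₂ κ l₂ N y) :
    (l₂ - l₁) * den A G₁ κ x y = -num A G₁ κ x y * (G₂ - G₁) := by
  -- The function `(y - x) * weight` vanishes at both ends, so the integral of its derivative is
  -- zero.
  have h0 := integral_of_hasDerivAt_of_tendsto
    (fun τ => hasDerivAt_sub_mul_weight hx.isSol hy.isSol τ)
    (integrable_weight_mul_source hκ hx hy _ _)
    (tendsto_sub_mul_weight hκ hx hy hx.tendsto_atBot hy.tendsto_atBot)
    (tendsto_sub_mul_weight hκ hx hy hx.tendsto_atTop hy.tendsto_atTop)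
  have hi1 := integrable_weight_mul hκ hx hy (f := sp) (by fun_prop) abs_sp_le_one
  have hyc := hy.isSol.continuous
  have hi2 := integrable_weight_mul hκ hx hy (f := fun τ => sp τ ^ 2 * sin (y τ)) (by fun_prop)
    (fun τ => (abs_sp_sq_mul_sin_le τ (y τ)).trans (sp_sq_le_one τ))
  have e : (fun τ => weight A G₁ κ x y τ * source y (G₂ - G₁) (l₂ - l₁) τ) = fun τ =>
      (2 * (l₂ - l₁)) * (weight A G₁ κ x y τ * sp τ) +
        (2 * (G₂ - G₁)) * (weight A G₁ κ x y τ * (sp τ ^ 2 * sin (y τ))) := by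
    funext τ; unfold source; ring
  rw [e, integral_add (hi1.const_mul _) (hi2.const_mul _), integral_const_mul,
    integral_const_mul] at h0
  unfold den num
  linarith

lemma sub_eq_div_mul (hκ : 0 < κ) (hx : IsConn A G₁ κ l₁ N x) (hy : IsConn A G₂ κ l₂ N y) :
    l₂ - l₁ = -(num A G₁ κ x y / den A G₁ κ x y) * (G₂ - G₁) := by
  have h := sub_mul_den_eq hκ hx hy
  have := (den_pos hκ hx hy).ne'
  field_simp
  linarith

/-- For `G₁ = G₂` this is the uniqueness of `l`. -/
lemma abs_sub_le_of_isConn (hκ : 0 < κ) (hx : IsConn A G₁ κ l₁ N x)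
    (hy : IsConn A G₂ κ l₂ N y) : |l₂ - l₁| ≤ |G₂ - G₁| := by
  have h := sub_eq_div_mul hκ hx hy
  rw [h, abs_mul, abs_neg, abs_div, abs_of_pos (den_pos hκ hx hy)]
  refine mul_le_of_le_one_left (abs_nonneg _) ?_
  rw [div_le_one (den_pos hκ hx hy)]
  exact (abs_num_lt_den hκ hx hy).le

/-- Two connectors are close at a given time when their parameters are close. -/
lemma abs_apply_sub_le (hκ : 0 < κ) (hx : IsConn A G₁ κ l₁ N x)
    (hy : IsConn A G₂ κ l₂ N y) {C : ℝ}
    (hC : ∀ τ, weight A G₁ κ x y τ ≤ C * exp (-(κ / 2) * |τ|)) (τ : ℝ) :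
    |y τ - x τ| ≤ exp (2 * (|A| + |G₁| + |κ|) * |τ|) *
      ((∫ σ, C * exp (-(κ / 2) * |σ|)) * (4 * |G₂ - G₁|)) := by
  -- Integrating from `-∞`, where both connectors tend to `0`, replaces a common initial value. The
  -- factor `4` below comes from `|l₂ - l₁| ≤ |G₂ - G₁|`.
  have h0 := integral_Iic_of_hasDerivAt_of_tendsto' (a := τ)
    (fun τ _ => hasDerivAt_sub_mul_weight hx.isSol hy.isSol τ)
    (integrable_weight_mul_source hκ hx hy _ _).integrableOn
    (tendsto_sub_mul_weight hκ hx hy hx.tendsto_atBot hy.tendsto_atBot)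
  rw [sub_zero] at h0
  have hd := abs_sub_le_of_isConn hκ hx hy
  have hI := ((integrable_exp_neg_mul_abs (half_pos hκ)).const_mul C).mul_const (4 * |G₂ - G₁|)
  have hnn : ∀ σ, 0 ≤ C * exp (-(κ / 2) * |σ|) := fun σ => (weight_pos A G₁ κ x y σ).le.trans (hC σ)
  have h1 : |(y τ - x τ) * weight A G₁ κ x y τ| ≤
      (∫ σ, C * exp (-(κ / 2) * |σ|)) * (4 * |G₂ - G₁|) := by
    rw [← h0, ← integral_mul_const, ← Real.norm_eq_abs]
    refine (norm_integral_le_of_norm_le hI.integrableOn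
      (Eventually.of_forall fun σ => ?_)).trans
      (setIntegral_le_integral hI (Eventually.of_forall fun σ =>
        mul_nonneg (hnn σ) (by positivity)))
    rw [norm_mul, Real.norm_eq_abs, Real.norm_eq_abs, abs_of_pos (weight_pos _ _ _ _ _ _)]
    exact mul_le_mul (hC σ) ((abs_source_le _ _ _ _).trans (by linarith)) (abs_nonneg _) (hnn σ)
  rw [abs_mul, abs_of_pos (weight_pos _ _ _ _ _ _)] at h1
  have h6 : 1 ≤ exp (2 * (|A| + |G₁| + |κ|) * |τ|) * weight A G₁ κ x y τ := by
    have := mul_le_mul_of_nonneg_left (le_weight A G₁ κ x y τ)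
      (exp_pos (2 * (|A| + |G₁| + |κ|) * |τ|)).le
    rwa [← exp_add, add_neg_cancel, exp_zero] at this
  calc |y τ - x τ| ≤ |y τ - x τ| * (exp (2 * (|A| + |G₁| + |κ|) * |τ|) * weight A G₁ κ x y τ) :=
        le_mul_of_one_le_right (abs_nonneg _) h6
    _ = exp (2 * (|A| + |G₁| + |κ|) * |τ|) * (|y τ - x τ| * weight A G₁ κ x y τ) := by ring
    _ ≤ _ := by gcongr

end Pair

/-! ### Existence of connectors by shooting -/

lemma IsSol.neg {A G κ l : ℝ} {x : ℝ → ℝ} (hx : IsSol A G κ l x) :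
    IsSol (-A) G κ (-l) (fun τ => -x τ) := by
  intro τ
  refine (hx τ).neg.congr_deriv ?_
  simp only [rhs, cos_neg, sin_neg]
  ring

/-- At multiples of `π` the sine term drops out and `l` dominates `A`; these levels can only be
crossed upwards. -/
lemma rhs_int_mul_pi_pos {A G κ l : ℝ} (hl : |A| < l) (τ : ℝ) (k : ℤ) :
    0 < rhs A G κ l τ (k * π) := by
  have h1 : |A * cp τ * cos (k * π)| ≤ |A| := by
    rw [abs_mul, abs_mul, mul_assoc]
    exact mul_le_of_le_one_right (abs_nonneg _)
      (mul_le_one₀ (abs_cp_le_one τ) (abs_nonneg _) (abs_cos_le_one _))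
  have h2 : rhs A G κ l τ (k * π) = 2 * sp τ * (l - A * cp τ * cos (k * π)) := by
    rw [rhs, sin_int_mul_pi]; ring
  rw [h2]
  exact mul_pos (mul_pos two_pos (sp_pos τ)) (by linarith [le_abs_self (A * cp τ * cos (k * π))])

/-- The barrier `0` holds until time `-1`; a large `l` lifts the solution by `2π|N|` during `[-1,
1]`, where `sp` is bounded below; the barrier `-2πN` holds afterwards. Hence `Λ` does not depend on
`T`. -/
lemma exists_forall_le_apply (A G κ : ℝ) (N : ℤ) :
    ∃ Λ : ℝ, 0 < Λ ∧ ∀ l x, Λ ≤ l → IsSol A G κ l x → ∀ T, 1 ≤ T → x (-T) = 0 →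
      -(2 * π * N) ≤ x T := by
  obtain ⟨τ₀, -, hmin⟩ := isCompact_Icc.exists_isMinOn (nonempty_Icc.2 (by norm_num : (-1 : ℝ) ≤ 1))
    continuous_sp.continuousOn
  set m := sp τ₀
  have hm : 0 < m := sp_pos τ₀
  set M := 2 * (|A| + |G|) + 2 * |κ|
  refine ⟨max (|A| + 1) ((π * |(N : ℝ)| + M) / (2 * m)), by positivity,
    fun l x hl hx T hT h0 => ?_⟩
  have hA : |A| < l := by linarith [(le_max_left _ _).trans hl]
  have hl0 : 0 < l := (abs_nonneg A).trans_lt hA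
  have hl2 := (le_max_right _ _).trans hl
  rw [div_le_iff₀ (by positivity)] at hl2
  have h1 : 0 ≤ x (-1) := by
    refine hx.le_of_rhs_pos (t₀ := -T) (t₁ := -1) h0.ge (fun τ _ => ?_) _ ⟨by linarith, le_rfl⟩
    simpa using rhs_int_mul_pi_pos hA τ 0
  have h2 : (2 * l * m - M) * (1 - (-1)) ≤ x 1 - x (-1) := by
    refine (convex_Icc (-1 : ℝ) 1).mul_sub_le_image_sub_of_le_deriv hx.continuous.continuousOn
      (fun τ _ => (hx τ).differentiableAt.differentiableWithinAt) (fun τ hτ => ?_)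
      (-1) (by simp) 1 (by simp) (by norm_num)
    rw [(hx τ).deriv]
    have h3 := (abs_le.1 (abs_rhs_le A G κ 0 τ (x τ))).1
    have h4 : m ≤ sp τ := hmin (interior_subset hτ)
    have h5 : rhs A G κ l τ (x τ) = rhs A G κ 0 τ (x τ) + 2 * l * sp τ := by unfold rhs; ring
    have h6 : 2 * l * m ≤ 2 * l * sp τ := by gcongr
    rw [abs_zero, add_zero] at h3
    linarith
  have h7 : ((-2 * N : ℤ) : ℝ) * π ≤ x 1 := by
    have := mul_le_mul_of_nonneg_left (neg_le_abs (N : ℝ)) pi_pos.le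
    push_cast
    linarith
  have h8 := hx.le_of_rhs_pos h7 (fun τ _ => rhs_int_mul_pi_pos hA τ _) T ⟨hT, le_rfl⟩
  push_cast at h8
  linarith

lemma exists_shooting (A G κ : ℝ) (N : ℤ) :
    ∃ Λ : ℝ, ∀ T, 1 ≤ T → ∃ l x, |l| ≤ Λ ∧ IsSol A G κ l x ∧ x (-T) = 0 ∧ x T = target N := by
  obtain ⟨Λ₁, hΛ₁, h₁⟩ := exists_forall_le_apply A G κ N
  obtain ⟨Λ₂, hΛ₂, h₂⟩ := exists_forall_le_apply (-A) G κ (-N - 1)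
  set Λ := max Λ₁ Λ₂
  have hΛ : 0 < Λ := lt_max_of_lt_left hΛ₁
  refine ⟨Λ, fun T hT => ?_⟩
  choose X hX0 hX using fun l => exists_isSol A G κ l (-T) 0
  have hcont : Continuous fun l => X l T := by
    set C := exp (2 * (|A| + |G| + |κ|) * (|T| + max |T| |-T|)) * (2 * |T - -T|)
    refine LipschitzWith.continuous (K := C.toNNReal)
      (LipschitzWith.of_dist_le_mul fun l₁ l₂ => ?_)
    have h := abs_sub_le_of_isSol (hX l₂) (hX l₁) (-T) T
    rw [hX0, hX0, sub_self, sub_self, abs_zero, zero_add, zero_add] at h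
    rw [Real.coe_toNNReal _ (by positivity), Real.dist_eq, Real.dist_eq]
    refine h.trans_eq ?_
    ring
  -- The lower bound applied to `-x` with winding number `-N - 1` puts `X (-Λ) T` at least `π` below
  -- the target.
  have hlow : X (-Λ) T ≤ target N := by
    have := h₂ Λ _ (le_max_right _ _) (by simpa using (hX (-Λ)).neg) T hT (by simp [hX0])
    push_cast at this
    unfold target
    linarith [pi_pos]
  have hup : target N ≤ X Λ T := by
    have := h₁ Λ _ (le_max_left _ _) (hX Λ) T hT (hX0 Λ)
    unfold target
    linarith [pi_pos]
  obtain ⟨l, hl, hl'⟩ := intermediate_value_Icc (by linarith : -Λ ≤ Λ) hcont.continuousOn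
    ⟨hlow, hup⟩
  exact ⟨l, X l, abs_le.2 hl, hX l, hX0 l, hl'⟩

/-- Each `X n` starts at `0`, hence stays within a small interval up to a time `-T₀` independent of
`n`; the bound survives the pointwise limit. -/
lemma tendsto_atBot_of_limit {A G κ R : ℝ} (hκ : 0 < κ) {l T : ℕ → ℝ} {X : ℕ → ℝ → ℝ}
    {x : ℝ → ℝ} (hl : ∀ n, |l n| ≤ R) (hT : Tendsto T atTop atTop)
    (hX : ∀ n, IsSol A G κ (l n) (X n)) (h0 : ∀ n, X n (-T n) = 0)
    (hlim : ∀ t, Tendsto (fun n => X n t) atTop (𝓝 (x t))) : Tendsto x atBot (𝓝 0) := by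
  rw [Metric.tendsto_nhds]
  intro ε hε
  have hε' : 0 < min (ε / 2) 1 := by positivity
  obtain ⟨T₀, -, h⟩ := exists_time_forall_abs_le A κ (max |G| R) _ hκ hε' (min_le_right _ _)
  filter_upwards [eventually_le_atBot (-T₀)] with τ hτ
  rw [Real.dist_eq, sub_zero]
  refine lt_of_le_of_lt (le_of_tendsto (hlim τ).abs ?_)
    ((min_le_left (ε / 2) 1).trans_lt (half_lt_self hε))
  filter_upwards [hT.eventually_ge_atTop (-τ)] with n hn
  refine h G (l n) (X n) (le_max_left _ _) ((hl n).trans (le_max_right _ _)) (hX n) (-T n) τ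
    (by linarith) hτ ?_
  rw [h0, abs_zero]; exact hε'.le

/-- For all values of the other parameters there is a connector of given winding number. -/
lemma exists_isConn (A G κ : ℝ) (hκ : 0 < κ) (N : ℤ) : ∃ l x, IsConn A G κ l N x := by
  obtain ⟨Λ, hΛ⟩ := exists_shooting A G κ N
  obtain ⟨T₀, hT₀, h⟩ := exists_time_forall_abs_le A κ (max |G| Λ) 1 hκ one_pos le_rfl
  have hT1 : ∀ n : ℕ, (1 : ℝ) ≤ n + 1 + T₀ := fun n => by
    have : (0 : ℝ) ≤ n := n.cast_nonneg
    linarith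
  choose l X hl hX hX0 hX1 using fun n : ℕ => hΛ (n + 1 + T₀) (hT1 n)
  -- Compactness is needed only for the parameter and the value at the one time `-T₀`; continuous
  -- dependence then gives convergence at every time.
  have hmem : ∀ n, (l n, X n (-T₀)) ∈ Icc (-Λ) Λ ×ˢ Icc (-1 : ℝ) 1 := by
    intro n
    refine ⟨abs_le.1 (hl n), abs_le.1 ?_⟩
    refine h G (l n) (X n) (le_max_left _ _) ((hl n).trans (le_max_right _ _)) (hX n)
      (-(n + 1 + T₀)) (-T₀) ?_ le_rfl (by rw [hX0, abs_zero]; exact zero_le_one)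
    have : (0 : ℝ) ≤ n := n.cast_nonneg
    linarith
  obtain ⟨⟨l', x₀⟩, -, φ, hφ, hlim⟩ :=
    (isCompact_Icc.prod isCompact_Icc).tendsto_subseq hmem
  rw [nhds_prod_eq, tendsto_prod_iff'] at hlim
  obtain ⟨hl', hx₀⟩ := hlim
  obtain ⟨x, hx, hsol⟩ := exists_isSol A G κ l' (-T₀) x₀
  have hpt : ∀ t, Tendsto (fun n => X (φ n) t) atTop (𝓝 (x t)) := by
    intro t
    have h1 : Tendsto (fun n => exp (2 * (|A| + |G| + |κ|) * (|t| + max |t| |-T₀|)) *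
        (|X (φ n) (-T₀) - x (-T₀)| + 2 * (|G - G| + |l (φ n) - l'|) * |t - -T₀|)) atTop (𝓝 0) := by
      have h2 : Tendsto (fun n => |X (φ n) (-T₀) - x (-T₀)|) atTop (𝓝 0) := by
        have := (hx₀.sub_const x₀).abs
        simpa [hx] using! this
      have h3 : Tendsto (fun n => |l (φ n) - l'|) atTop (𝓝 0) := by
        have := (hl'.sub_const l').abs
        simpa using! this
      have h4 := (h2.add (((h3.const_add |G - G|).const_mul 2).mul_const |t - -T₀|)).const_mul
        (exp (2 * (|A| + |G| + |κ|) * (|t| + max |t| |-T₀|)))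
      simpa using h4
    rw [tendsto_iff_dist_tendsto_zero]
    exact squeeze_zero (fun _ => dist_nonneg)
      (fun n => abs_sub_le_of_isSol hsol (hX (φ n)) (-T₀) t) h1
  have hTt : Tendsto (fun n => (φ n : ℝ) + 1 + T₀) atTop atTop :=
    tendsto_atTop_add_const_right _ _ (tendsto_atTop_add_const_right _ _
      (tendsto_natCast_atTop_atTop.comp hφ.tendsto_atTop))
  refine ⟨l', x, hsol, ?_, ?_⟩
  · exact tendsto_atBot_of_limit hκ (fun n => hl (φ n)) hTt (fun n => hX (φ n))
      (fun n => hX0 (φ n)) hpt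
  -- The reflected solutions vanish at `-T` because the original ones hit the target at `T`.
  · have h1 := tendsto_atBot_of_limit (R := Λ) hκ (l := fun n => -l (φ n))
      (x := fun τ => x (-τ) - target N)
      (fun n => by rw [abs_neg]; exact hl (φ n)) hTt (fun n => (hX (φ n)).reflect N)
      (fun n => by rw [neg_neg, hX1, sub_self]) (fun t => (hpt (-t)).sub_const _)
    have h2 := (h1.comp tendsto_neg_atTop_atBot).add_const (target N)
    simpa [Function.comp_def] using h2

/-! ### Differentiable dependence of the parameter -/

lemma continuous_rhsDeriv (A κ τ : ℝ) : Continuous fun p : ℝ × ℝ => rhsDeriv A p.1 κ τ p.2 := by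
  unfold rhsDeriv; fun_prop

section Limit

variable {ι : Type*} {f : Filter ι} {A κ R : ℝ} {G : ι → ℝ} {X Y : ι → ℝ → ℝ} {G₀ : ℝ}
  {x : ℝ → ℝ}

lemma tendsto_coeff (hG : Tendsto G f (𝓝 G₀)) (hX : ∀ t, Tendsto (fun i => X i t) f (𝓝 (x t)))
    (hY : ∀ t, Tendsto (fun i => Y i t) f (𝓝 (x t))) (τ : ℝ) :
    Tendsto (fun i => coeff A (G i) κ (X i) (Y i) τ) f (𝓝 (coeff A G₀ κ x x τ)) := by
  have h1 := (continuous_sinc.tendsto ((x τ - x τ) / 2)).comp (((hY τ).sub (hX τ)).div_const 2)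
  have h2 := ((continuous_rhsDeriv A κ τ).tendsto (G₀, (x τ + x τ) / 2)).comp
    (hG.prodMk_nhds (((hX τ).add (hY τ)).div_const 2))
  exact h1.mul h2

lemma tendsto_weight [f.IsCountablyGenerated] (hR : ∀ᶠ i in f, |G i| ≤ R)
    (hXc : ∀ i, Continuous (X i)) (hYc : ∀ i, Continuous (Y i)) (hG : Tendsto G f (𝓝 G₀))
    (hX : ∀ t, Tendsto (fun i => X i t) f (𝓝 (x t)))
    (hY : ∀ t, Tendsto (fun i => Y i t) f (𝓝 (x t))) (τ : ℝ) :
    Tendsto (fun i => weight A (G i) κ (X i) (Y i) τ) f (𝓝 (weight A G₀ κ x x τ)) := by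
  have h : Tendsto (fun i => ∫ σ in (0 : ℝ)..τ, coeff A (G i) κ (X i) (Y i) σ) f
      (𝓝 (∫ σ in (0 : ℝ)..τ, coeff A G₀ κ x x σ)) := by
    refine intervalIntegral.tendsto_integral_filter_of_dominated_convergence
      (fun _ => 2 * (|A| + R + |κ|)) ?_ ?_ intervalIntegrable_const ?_
    · exact Eventually.of_forall fun i =>
        (continuous_coeff A (G i) κ (hXc i) (hYc i)).aestronglyMeasurable
    · filter_upwards [hR] with i hi
      refine Eventually.of_forall fun σ _ => (abs_coeff_le A (G i) κ (X i) (Y i) σ).trans ?_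
      gcongr
    · exact Eventually.of_forall fun σ _ => tendsto_coeff hG hX hY σ
  exact (continuous_exp.tendsto _).comp h.neg

/-- Dominated convergence, with the uniform exponential bound on the weights as majorant. -/
lemma tendsto_integral_weight_mul [f.IsCountablyGenerated] {C : ℝ} (hκ : 0 < κ)
    (hR : ∀ᶠ i in f, |G i| ≤ R)
    (hC : ∀ᶠ i in f, ∀ τ, weight A (G i) κ (X i) (Y i) τ ≤ C * exp (-(κ / 2) * |τ|))
    (hXc : ∀ i, Continuous (X i)) (hYc : ∀ i, Continuous (Y i)) (hG : Tendsto G f (𝓝 G₀))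
    (hX : ∀ t, Tendsto (fun i => X i t) f (𝓝 (x t)))
    (hY : ∀ t, Tendsto (fun i => Y i t) f (𝓝 (x t))) {g : ι → ℝ → ℝ} {g₀ : ℝ → ℝ}
    (hgc : ∀ i, Continuous (g i)) (hg1 : ∀ i τ, |g i τ| ≤ 1)
    (hg : ∀ t, Tendsto (fun i => g i t) f (𝓝 (g₀ t))) :
    Tendsto (fun i => ∫ τ, weight A (G i) κ (X i) (Y i) τ * g i τ) f
      (𝓝 (∫ τ, weight A G₀ κ x x τ * g₀ τ)) := by
  refine tendsto_integral_filter_of_dominated_convergence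
    (fun τ => C * exp (-(κ / 2) * |τ|)) ?_ ?_
    ((integrable_exp_neg_mul_abs (half_pos hκ)).const_mul C) ?_
  · exact Eventually.of_forall fun i =>
      ((continuous_weight A (G i) κ (hXc i) (hYc i)).mul (hgc i)).aestronglyMeasurable
  · filter_upwards [hC] with i hi
    refine Eventually.of_forall fun τ => ?_
    rw [norm_mul, Real.norm_eq_abs, Real.norm_eq_abs, abs_of_pos (weight_pos _ _ _ _ _ _)]
    exact (mul_le_of_le_one_right (weight_pos _ _ _ _ _ _).le (hg1 i τ)).trans (hi τ)
  · exact Eventually.of_forall fun τ => (tendsto_weight hR hXc hYc hG hX hY τ).mul (hg τ)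

lemma tendsto_num_div_den [f.IsCountablyGenerated] {C : ℝ} (hκ : 0 < κ)
    (hR : ∀ᶠ i in f, |G i| ≤ R)
    (hC : ∀ᶠ i in f, ∀ τ, weight A (G i) κ (X i) (Y i) τ ≤ C * exp (-(κ / 2) * |τ|))
    (hXc : ∀ i, Continuous (X i)) (hYc : ∀ i, Continuous (Y i)) (hG : Tendsto G f (𝓝 G₀))
    (hX : ∀ t, Tendsto (fun i => X i t) f (𝓝 (x t)))
    (hY : ∀ t, Tendsto (fun i => Y i t) f (𝓝 (x t))) (h0 : den A G₀ κ x x ≠ 0) :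
    Tendsto (fun i => num A (G i) κ (X i) (Y i) / den A (G i) κ (X i) (Y i)) f
      (𝓝 (num A G₀ κ x x / den A G₀ κ x x)) := by
  refine Tendsto.div ?_ ?_ h0
  · exact tendsto_integral_weight_mul hκ hR hC hXc hYc hG hX hY
      (fun i => by have := hYc i; fun_prop)
      (fun i τ => (abs_sp_sq_mul_sin_le τ (Y i τ)).trans (sp_sq_le_one τ))
      (fun t => ((continuous_sin.tendsto _).comp (hY t)).const_mul _)
  · exact tendsto_integral_weight_mul hκ hR hC hXc hYc hG hX hY
      (fun _ => continuous_sp) (fun _ => abs_sp_le_one) (fun t => tendsto_const_nhds)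

end Limit

section Family

variable {A κ : ℝ} {N : ℤ} {lam : ℝ → ℝ} {X : ℝ → ℝ → ℝ}

lemma continuous_param (hκ : 0 < κ) (h : ∀ G, IsConn A G κ (lam G) N (X G)) :
    Continuous lam :=
  LipschitzWith.continuous (K := 1) (LipschitzWith.of_dist_le_mul fun G₁ G₂ => by
    rw [NNReal.coe_one, one_mul]
    exact abs_sub_le_of_isConn hκ (h G₂) (h G₁))

/-- Near a given parameter the weights of a family of connectors decay uniformly. -/
lemma exists_eventually_weight_le (hκ : 0 < κ) (h : ∀ G, IsConn A G κ (lam G) N (X G)) (G₀ : ℝ) :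
    ∃ C R : ℝ, (∀ᶠ G in 𝓝 G₀, |G| ≤ R) ∧ ∀ᶠ p : ℝ × ℝ in 𝓝 (G₀, G₀), ∀ τ,
      weight A p.1 κ (X p.1) (X p.2) τ ≤ C * exp (-(κ / 2) * |τ|) := by
  set R := max |G₀| |lam G₀| + 1
  obtain ⟨C, -, hC⟩ := exists_weight_le A κ R hκ
  have h1 : ∀ᶠ G in 𝓝 G₀, |G| ≤ R :=
    continuous_abs.continuousAt.eventually_le_const
      (lt_of_le_of_lt (le_max_left _ _) (lt_add_one _))
  have h2 : ∀ᶠ G in 𝓝 G₀, |lam G| ≤ R :=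
    (continuous_param hκ h).abs.continuousAt.eventually_le_const
      (lt_of_le_of_lt (le_max_right |G₀| |lam G₀|) (lt_add_one _))
  have h3 := h1.and h2
  refine ⟨C, R, h1, ?_⟩
  rw [nhds_prod_eq]
  filter_upwards [h3.prod_mk h3] with p hp
  exact hC N p.1 p.2 _ _ _ _ hp.1.1 hp.2.1 hp.1.2 hp.2.2 (h _) (h _)

/-- `C` is uniform near `G₀`, so `abs_apply_sub_le` bounds the change by a multiple of `|G - G₀|`.
-/
lemma continuous_conn_apply (hκ : 0 < κ) (h : ∀ G, IsConn A G κ (lam G) N (X G)) (τ : ℝ) :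
    Continuous fun G => X G τ := by
  refine continuous_iff_continuousAt.2 fun G₀ => ?_
  obtain ⟨C, R, -, hC⟩ := exists_eventually_weight_le hκ h G₀
  have hC' : ∀ᶠ G in 𝓝 G₀, ∀ τ, weight A G₀ κ (X G₀) (X G) τ ≤ C * exp (-(κ / 2) * |τ|) :=
    (Continuous.prodMk_right G₀).continuousAt.eventually hC
  rw [ContinuousAt, tendsto_iff_dist_tendsto_zero]
  refine squeeze_zero' (Eventually.of_forall fun _ => dist_nonneg)
    (hC'.mono fun G hG => abs_apply_sub_le hκ (h G₀) (h G) hG τ) ?_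
  have : Continuous fun G => exp (2 * (|A| + |G₀| + |κ|) * |τ|) *
      ((∫ σ, C * exp (-(κ / 2) * |σ|)) * (4 * |G - G₀|)) := by fun_prop
  simpa using this.tendsto G₀

/-- The slope of the parameter between two connectors. -/
def slopeParam (A κ : ℝ) (X : ℝ → ℝ → ℝ) (p : ℝ × ℝ) : ℝ :=
  -(num A p.1 κ (X p.1) (X p.2) / den A p.1 κ (X p.1) (X p.2))

/-- The joint limit serves twice: with the first entry fixed it gives the derivative, along the
diagonal its continuity. -/
lemma tendsto_slopeParam (hκ : 0 < κ) (h : ∀ G, IsConn A G κ (lam G) N (X G)) (G₀ : ℝ) :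
    Tendsto (slopeParam A κ X) (𝓝 (G₀, G₀)) (𝓝 (slopeParam A κ X (G₀, G₀))) := by
  obtain ⟨C, R, hR, hC⟩ := exists_eventually_weight_le hκ h G₀
  have h1 : Tendsto (fun p : ℝ × ℝ => p.1) (𝓝 (G₀, G₀)) (𝓝 G₀) := continuous_fst.tendsto (G₀, G₀)
  have h2 : Tendsto (fun p : ℝ × ℝ => p.2) (𝓝 (G₀, G₀)) (𝓝 G₀) := continuous_snd.tendsto (G₀, G₀)
  exact (tendsto_num_div_den hκ (h1.eventually hR) hC (fun p => (h p.1).isSol.continuous)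
    (fun p => (h p.2).isSol.continuous) h1
    (fun t => ((continuous_conn_apply hκ h t).tendsto G₀).comp h1)
    (fun t => ((continuous_conn_apply hκ h t).tendsto G₀).comp h2)
    (den_pos hκ (h G₀) (h G₀)).ne').neg

lemma hasDerivAt_param (hκ : 0 < κ) (h : ∀ G, IsConn A G κ (lam G) N (X G)) (G₀ : ℝ) :
    HasDerivAt lam (slopeParam A κ X (G₀, G₀)) G₀ := by
  rw [hasDerivAt_iff_tendsto_slope]
  have h1 := ((tendsto_slopeParam hκ h G₀).comp
    ((Continuous.prodMk_right G₀).tendsto G₀)).mono_left (nhdsWithin_le_nhds (s := {G₀}ᶜ))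
  refine h1.congr' ?_
  filter_upwards [self_mem_nhdsWithin] with G hG
  have hG' : G - G₀ ≠ 0 := sub_ne_zero.2 hG
  rw [slope_def_field, sub_eq_div_mul hκ (h G₀) (h G), mul_div_cancel_right₀ _ hG']
  rfl

lemma abs_slopeParam_lt_one (hκ : 0 < κ) (h : ∀ G, IsConn A G κ (lam G) N (X G)) (G₀ : ℝ) :
    |slopeParam A κ X (G₀, G₀)| < 1 := by
  have hd := den_pos hκ (h G₀) (h G₀)
  rw [slopeParam, abs_neg, abs_div, abs_of_pos hd, div_lt_one hd]
  exact abs_num_lt_den hκ (h G₀) (h G₀)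

end Family

/-- Scalar form of the main theorem. -/
lemma exists_param (A κ : ℝ) (hκ : 0 < κ) (N : ℤ) :
    ∃ lam : ℝ → ℝ, (∀ G l, (∃ x, IsConn A G κ l N x) ↔ l = lam G) ∧ ContDiff ℝ 1 lam ∧
      ∀ G, |deriv lam G| < 1 := by
  choose lam X h using fun G => exists_isConn A G κ hκ N
  have hd := hasDerivAt_param hκ h
  refine ⟨lam, fun G l => ⟨?_, ?_⟩, ?_, fun G => ?_⟩
  · rintro ⟨x, hx⟩
    have := abs_sub_le_of_isConn hκ (h G) hx
    rw [sub_self, abs_zero] at this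
    exact sub_eq_zero.1 (abs_nonpos_iff.1 this)
  · rintro rfl
    exact ⟨X G, h G⟩
  · rw [contDiff_one_iff_deriv]
    refine ⟨fun G => (hd G).differentiableAt, ?_⟩
    rw [funext fun G => (hd G).deriv]
    refine continuous_iff_continuousAt.2 fun G₀ => ?_
    exact (tendsto_slopeParam hκ h G₀).comp
      ((continuous_id.prodMk continuous_id).tendsto G₀)
  · rw [(hd G).deriv]
    exact abs_slopeParam_lt_one hκ h G

/-! ### Orbits of the `Θ`-system and the scalar equation -/

lemma exists_polar_eq {θ : ℝ} (h : θ ∈ Ioo 0 π) : ∃ τ, polar τ = θ := by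
  have ht : 0 < tan (θ / 2) := tan_pos_of_pos_of_lt_pi_div_two (by linarith [h.1]) (by linarith [h.2])
  refine ⟨log (tan (θ / 2)), ?_⟩
  rw [polar, exp_log ht, arctan_tan (by linarith [h.1, pi_pos]) (by linarith [h.2])]
  ring

lemma exists_eq_polar_add {θ : ℝ → ℝ} (h : ∀ τ, HasDerivAt θ (sin (θ τ)) τ)
    (h0 : θ 0 ∈ Ioo 0 π) : ∃ τ₀, ∀ τ, θ τ = polar (τ + τ₀) := by
  obtain ⟨τ₀, hτ₀⟩ := exists_polar_eq h0
  refine ⟨τ₀, fun τ => ?_⟩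
  refine congrFun (ODE_solution_unique_univ (v := fun _ => sin) (s := fun _ => univ) (K := 1)
    (g := fun τ => polar (τ + τ₀)) (t₀ := 0) (fun _ => ?_) (fun t => ⟨h t, mem_univ _⟩)
    (fun t => ⟨?_, mem_univ _⟩) ?_) τ
  · exact lipschitzWith_sin.lipschitzOnWith
  · exact (hasDerivAt_polar (t + τ₀)).comp_add_const t τ₀
  · simp only [zero_add, hτ₀]

/-- Used with `(ε, b) = (1, 0)` and `(-1, π)`; the sign is absorbed into `a` and `κ`, while `l` is
unchanged. -/
lemma field_polar {ε b : ℝ} (hc : ∀ x, cos (x + b) = ε * cos x)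
    (hs : ∀ x, sin (x + b) = ε * sin x) (a E κ l τ x : ℝ) :
    field a E κ l (polar τ, x + b) = (sp τ, rhs (ε * a) (ε * a * E) (ε * κ) l τ x) := by
  refine Prod.ext rfl ?_
  simp only [field, rhs, hc, hs, sp, cp]
  ring

lemma IsConn.hasConnector {a E κ l ε b : ℝ} {N : ℤ} {x : ℝ → ℝ}
    (hc : ∀ x, cos (x + b) = ε * cos x) (hs : ∀ x, sin (x + b) = ε * sin x)
    (hl : saddleLeft κ = (0, b)) (hr : saddleRight κ = (π, b - π))
    (hx : IsConn (ε * a) (ε * a * E) (ε * κ) l N x) : HasConnector a E κ l N := by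
  have htop : Tendsto (fun τ => (polar τ, x τ + b)) atTop (𝓝 (copy (saddleRight κ) N)) := by
    have e : copy (saddleRight κ) N = (π, target N + b) := by
      rw [hr, copy, target]; exact Prod.ext rfl (by ring)
    rw [e]
    exact tendsto_polar_atTop.prodMk_nhds (hx.tendsto_atTop.add_const b)
  refine ⟨fun τ => (polar τ, x τ + b), ⟨⟨⟨fun τ => ⟨polar_pos τ, polar_lt_pi τ⟩, fun τ => ?_⟩, ?_⟩,
    N, htop⟩, Or.inl htop⟩
  · rw [field_polar hc hs]
    exact (hasDerivAt_polar τ).prodMk ((hx.isSol τ).add_const b)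
  · rw [hl]
    simpa using tendsto_polar_atBot.prodMk_nhds (hx.tendsto_atBot.add_const b)

lemma HasConnector.exists_isConn {a E κ l ε b : ℝ} {N : ℤ}
    (hc : ∀ x, cos (x + b) = ε * cos x) (hs : ∀ x, sin (x + b) = ε * sin x)
    (hl : saddleLeft κ = (0, b)) (hr : saddleRight κ = (π, b - π)) (hn : nodeRight κ = (π, b))
    (h : HasConnector a E κ l N) : ∃ x, IsConn (ε * a) (ε * a * E) (ε * κ) l N x := by
  obtain ⟨γ, ⟨hγ, k, hk⟩, hN⟩ := h
  have htop : Tendsto γ atTop (𝓝 (copy (saddleRight κ) N)) := by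
    refine hN.resolve_right fun hN => ?_
    -- Copies of `S⁺` and `N⁺` differ in height by odd multiples of `π`, so a connector cannot end
    -- at a node.
    have e := congrArg Prod.snd (tendsto_nhds_unique hk hN)
    simp only [hr, hn, copy] at e
    have e2 : π * ((2 * k + 1 : ℤ) : ℝ) = π * ((2 * N : ℤ) : ℝ) := by push_cast; linarith
    have e3 : 2 * k + 1 = 2 * N := by exact_mod_cast mul_left_cancel₀ pi_ne_zero e2
    omega
  obtain ⟨τ₀, hτ₀⟩ := exists_eq_polar_add (θ := fun τ => (γ τ).1)
    (fun τ => (hasFDerivAt_fst (𝕜 := ℝ) (p := γ τ)).comp_hasDerivAt τ (hγ.hasDerivAt τ)) (hγ.mem 0)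
  have hγ2 : ∀ τ, γ (τ - τ₀) = (polar τ, ((γ (τ - τ₀)).2 - b) + b) := fun τ =>
    Prod.ext (by rw [hτ₀, sub_add_cancel]) (by simp)
  refine ⟨fun τ => (γ (τ - τ₀)).2 - b, fun τ => ?_, ?_, ?_⟩
  · have h1 := hγ.hasDerivAt (τ - τ₀)
    have h2 := (hasFDerivAt_snd.comp_hasDerivAt _ h1).comp_sub_const τ τ₀
    rw [hγ2 τ, field_polar hc hs] at h2
    exact h2.sub_const b
  · have h1 := (continuous_snd.tendsto _).comp
      (hγ.tendsto_atBot.comp (tendsto_atBot_add_const_right atBot (-τ₀) tendsto_id))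
    rw [hl] at h1
    simpa [sub_eq_add_neg] using! h1.sub_const b
  · have h1 := (continuous_snd.tendsto _).comp
      (htop.comp (tendsto_atTop_add_const_right atTop (-τ₀) tendsto_id))
    rw [hr] at h1
    have h2 := h1.sub_const b
    have e : (copy (π, b - π) N).2 - b = target N := by rw [copy, target]; ring
    rw [e] at h2
    simpa [sub_eq_add_neg] using! h2

lemma exists_param_hasConnector {a κ ε b : ℝ} (ha : 0 < a) (hε : |ε| = 1) (hκ : 0 < ε * κ)
    (N : ℤ) (hc : ∀ x, cos (x + b) = ε * cos x) (hs : ∀ x, sin (x + b) = ε * sin x)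
    (hl : saddleLeft κ = (0, b)) (hr : saddleRight κ = (π, b - π)) (hn : nodeRight κ = (π, b)) :
    ∃ lam : ℝ → ℝ, (∀ E l, HasConnector a E κ l N ↔ l = lam E) ∧ ContDiff ℝ 1 lam ∧
      ∀ E, |deriv lam E| < a := by
  obtain ⟨lam, h1, h2, h3⟩ := exists_param (ε * a) (ε * κ) hκ N
  refine ⟨fun E => lam (ε * a * E), fun E l => ?_, h2.comp (contDiff_const.mul contDiff_id),
    fun E => ?_⟩
  · rw [← h1]
    exact ⟨fun h => h.exists_isConn hc hs hl hr hn, fun ⟨x, hx⟩ => hx.hasConnector hc hs hl hr⟩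
  · rw [deriv_comp_mul_left, smul_eq_mul, abs_mul, abs_mul, hε, one_mul, abs_of_pos ha]
    exact mul_lt_of_lt_one_right ha (h3 _)

end

end ThetaSystem

theorem mainTheorem8 (a : ℝ) (ha : 0 < a) (κ : ℝ) (hκ : ∃ k : ℤ, κ = k + 1 / 2) (N : ℤ) :
    ∃ lam : ℝ → ℝ,
      (∀ E ∈ Icc (0 : ℝ) 1, ∀ l : ℝ, ThetaSystem.HasConnector a E κ l N ↔ l = lam E) ∧
      ContDiffOn ℝ 1 lam (Icc 0 1) ∧
      ∀ E ∈ Icc (0 : ℝ) 1, |derivWithin lam (Icc 0 1) E| < a := by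
  have main : ∃ lam : ℝ → ℝ, (∀ E l, ThetaSystem.HasConnector a E κ l N ↔ l = lam E) ∧
      ContDiff ℝ 1 lam ∧ ∀ E, |deriv lam E| < a := by
    -- Half-integrality enters only through `κ ≠ 0`.
    have hκ0 : κ ≠ 0 := by
      obtain ⟨k, rfl⟩ := hκ
      intro h
      have : ((2 * k + 1 : ℤ) : ℝ) = 0 := by push_cast; linarith
      have : 2 * k + 1 = 0 := by exact_mod_cast this
      omega
    rcases hκ0.lt_or_gt with h | h
    · have h' : ¬ 0 < κ := h.le.not_gt
      refine ThetaSystem.exists_param_hasConnector (ε := -1) (b := Real.pi) ha (by norm_num)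
        (by linarith) N (fun x => ?_) (fun x => ?_) ?_ ?_ ?_
      · rw [Real.cos_add_pi]; ring
      · rw [Real.sin_add_pi]; ring
      · rw [ThetaSystem.saddleLeft, if_neg h']
      · rw [ThetaSystem.saddleRight, if_neg h', sub_self]
      · rw [ThetaSystem.nodeRight, if_neg h']
    · refine ThetaSystem.exists_param_hasConnector (ε := 1) (b := 0) ha (by norm_num)
        (by linarith) N (fun x => ?_) (fun x => ?_) ?_ ?_ ?_
      · rw [add_zero, one_mul]
      · rw [add_zero, one_mul]
      · rw [ThetaSystem.saddleLeft, if_pos h]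
      · rw [ThetaSystem.saddleRight, if_pos h, zero_sub]
      · rw [ThetaSystem.nodeRight, if_pos h]
  obtain ⟨lam, h1, h2, h3⟩ := main
  refine ⟨lam, fun E _ l => h1 E l, h2.contDiffOn, fun E hE => ?_⟩
  rw [(h2.differentiable one_ne_zero E).derivWithin (uniqueDiffOn_Icc one_pos E hE)]
  exact h3 E
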